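/- Consider a finite system of sporadic tasks on a single processor under preemptive fixed-priority scheduling, with pairwise distinct priority levels. Task $\tau_i$ has worst-case execution time $C_i\ge 0$, period (minimum separation of consecutive job releases) $T_i>0$, relative deadline $D_i>0$, and utilization $U_i=C_i/T_i$; deadlines are arbitrary, i.e. no relation between $D_i$ and $T_i$ is assumed. A job of $\tau_i$ needs at most $C_i$ units of processor time, jobs of one task execute in order of release, and at every time the processor executes the ready job of highest priority, idling only when no job is ready. A task is schedulable if, for every legal sequence of job releases and execution times, each of its jobs released at a time $r$ finishes no later than $r$ plus the relative deadline of the task. Fix a task $\tau_k$. Let $hp_1(\tau_k)$ and $hp_2(\tau_k)$ be the sets of tasks $\tau_i$ with higher priority than $\tau_k$ such that $T_i<D_k$ and $T_i\ge D_k$, respectively. Let $k^*=|hp_1(\tau_k)|+1$ and $$C_k'=\left\lceil \frac{D_k}{T_k}\right\rceil C_k+\sum_{\tau_i\in hp_2(\tau_k)}C_i .$$ Theorem. Task $\tau_k$ is schedulable if $$\left(\frac{C_k'}{D_k}+1\right)\prod_{\tau_j\in hp_1(\tau_k)}(U_j+1)\le 2$$ or $$\frac{C_k'}{D_k}+\sum_{\tau_j\in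 hp_1(\tau_k)}U_j\le k^*\left(2^{1/k^*}-1\right).$$ -/

import Mathlib

/-- A finite system of sporadic real-time tasks on one processor, with arbitrary relative deadlines
(no relation between `D i` and `T i` is imposed) and with pairwise distinct fixed priority levels
(a smaller number means a higher priority). -/
structure SporadicSystem (ι : Type*) where
  /-- worst-case execution time -/
  C : ι → ℝ
  /-- period, i.e. minimum separation of consecutive releases -/
  T : ι → ℝ
  /-- relative deadline -/
  D : ι → ℝ
  /-- fixed priority level -/
  prio : ι → ℕ
  C_nonneg : ∀ i, 0 ≤ C i
  T_pos : ∀ i, 0 < T i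
  D_pos : ∀ i, 0 < D i
  prio_injective : Function.Injective prio

namespace SporadicSystem

section Behaviour

variable {ι : Type*}

/-- A legal job arrival sequence: the `j`-th job of task `i` is released at time `release i j` and
needs `exec i j` units of processor time. The execution time of a job never exceeds the worst case;
jobs that need exactly `C i` are included. -/
structure Arrivals (S : SporadicSystem ι) where
  release : ι → ℕ → ℝ
  exec : ι → ℕ → ℝ
  release_nonneg : ∀ i j, 0 ≤ release i j
  release_sep : ∀ i j, release i j + S.T i ≤ release i (j + 1)
  exec_nonneg : ∀ i j, 0 ≤ exec i j
  exec_le : ∀ i j, exec i j ≤ S.C i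

/-- The processor time that job `J = (i, j)` receives during `[0, t)`, where `σ s` is the job that
executes at time `s` (`none` when the processor idles). -/
noncomputable def service (σ : ℝ → Option (ι × ℕ)) (J : ι × ℕ) (t : ℝ) : ℝ :=
  MeasureTheory.volume.real {s : ℝ | s ∈ Set.Ico 0 t ∧ σ s = some J}

variable {S : SporadicSystem ι}

/-- Job `J` is in the ready queue at time `t`: it has been released and is not finished. -/
def Arrivals.Ready (A : S.Arrivals) (σ : ℝ → Option (ι × ℕ)) (J : ι × ℕ) (t : ℝ) : Prop :=
  A.release J.1 J.2 ≤ t ∧ service σ J t < A.exec J.1 J.2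

/-- Job `J` takes precedence over job `J'`: its task has higher priority, or both are jobs of the
same task and `J` is the earlier one. -/
def Precedes (S : SporadicSystem ι) (J J' : ι × ℕ) : Prop :=
  S.prio J.1 < S.prio J'.1 ∨ (J.1 = J'.1 ∧ J.2 < J'.2)

/-- `σ` is a preemptive fixed-priority schedule of the arrivals `A` on one processor: at every
time it executes the ready job that takes precedence over all other ready jobs, and it idles only
when no job is ready. -/
structure IsFixedPrioritySchedule (A : S.Arrivals) (σ : ℝ → Option (ι × ℕ)) : Prop where
  measurable : ∀ J, MeasurableSet {t : ℝ | σ t = some J}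
  ready : ∀ t J, σ t = some J → A.Ready σ J t
  highest : ∀ t J, σ t = some J → ∀ J', A.Ready σ J' t → ¬ S.Precedes J' J
  idle : ∀ t, σ t = none → ∀ J, ¬ A.Ready σ J t

/-- Task `k` is schedulable under preemptive fixed-priority scheduling: for all legal arrivals and
every resulting schedule, each job of task `k` has finished by its absolute deadline. -/
def Schedulable (S : SporadicSystem ι) (k : ι) : Prop :=
  ∀ (A : S.Arrivals) (σ : ℝ → Option (ι × ℕ)), IsFixedPrioritySchedule A σ →
    ∀ j : ℕ, A.exec k j ≤ service σ (k, j) (A.release k j + S.D k)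

end Behaviour

section Parameters

variable {ι : Type*} [Fintype ι]

/-- The utilization of task `i`. -/
noncomputable def U (S : SporadicSystem ι) (i : ι) : ℝ := S.C i / S.T i

/-- The tasks with higher priority than task `k`. -/
def hp (S : SporadicSystem ι) (k : ι) : Finset ι :=
  Finset.univ.filter fun i => S.prio i < S.prio k

/-- The higher-priority tasks with period smaller than `D k`. -/
noncomputable def hp₁ (S : SporadicSystem ι) (k : ι) : Finset ι :=
  (S.hp k).filter fun i => S.T i < S.D k

/-- The higher-priority tasks with period at least `D k`. -/
noncomputable def hp₂ (S : SporadicSystem ι) (k : ι) : Finset ι :=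
  (S.hp k).filter fun i => S.D k ≤ S.T i

/-- `⌈D k / T k⌉ * C k` plus the execution times of the tasks in `hp₂ k`. -/
noncomputable def C' (S : SporadicSystem ι) (k : ι) : ℝ :=
  (⌈S.D k / S.T k⌉ : ℝ) * S.C k + ∑ i ∈ S.hp₂ k, S.C i

/-- One more than the number of tasks in `hp₁ k`. -/
noncomputable def kStar (S : SporadicSystem ι) (k : ι) : ℕ := (S.hp₁ k).card + 1

end Parameters

end SporadicSystem

/-! Call a time quiet when all work of priority at least that of `k` released before it is finished.
If the work releasable in a window of length `t` is at most `t`, each quiet time is followed by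
another within distance `t`. A job of `k` released at `r` is finished at the first such time after
the last quiet time up to `r`, hence by `r + t`. So one `t ≤ D k` with demand at most `t` suffices
(`schedulable_of_workload_le`).

For `t ≤ D k`, each task of `hp₂` contributes at most one job and `k` at most `⌈D k / T k⌉`, so
together at most `c = C' k`. For `hp₁` the candidates are `D k` and the last multiple of each period
up to `D k`. If all of them fail, the resulting inequalities chain into a product that contradicts
the hyperbolic bound (`exists_workload_le_of_hyperbolic`). The utilization bound implies the
hyperbolic one by an inequality of AM-GM type. -/

namespace SporadicSystem

/-! ### Processor time, quiet times and the time-demand test -/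

section Service

variable {ι : Type*}

theorem service_nonneg (σ : ℝ → Option (ι × ℕ)) (J : ι × ℕ) (t : ℝ) : 0 ≤ service σ J t :=
  MeasureTheory.measureReal_nonneg

theorem service_set_ne_top (σ : ℝ → Option (ι × ℕ)) (J : ι × ℕ) (t : ℝ) :
    MeasureTheory.volume {s : ℝ | s ∈ Set.Ico 0 t ∧ σ s = some J} ≠ ⊤ :=
  ne_top_of_le_ne_top (measure_Ico_lt_top (a := (0 : ℝ)) (b := t)).ne
    (MeasureTheory.measure_mono fun _ hs => hs.1)

theorem service_mono (σ : ℝ → Option (ι × ℕ)) (J : ι × ℕ) : Monotone (service σ J) := by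
  intro s t hst
  exact MeasureTheory.measureReal_mono
    (fun u hu => ⟨⟨hu.1.1, hu.1.2.trans_le hst⟩, hu.2⟩) (service_set_ne_top σ J t)

variable {S : SporadicSystem ι} {A : S.Arrivals} {σ : ℝ → Option (ι × ℕ)}

/-- No job receives more processor time than it needs. -/
theorem service_le_exec (hσ : IsFixedPrioritySchedule A σ) (J : ι × ℕ) (t : ℝ) :
    service σ J t ≤ A.exec J.1 J.2 := by
  set E : Set ℝ := {s : ℝ | s ∈ Set.Ico 0 t ∧ σ s = some J} with hE
  rcases E.eq_empty_or_nonempty with h0 | hne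
  · have : service σ J t = 0 := by
      unfold service
      rw [← hE, h0, MeasureTheory.measureReal_empty]
    rw [this]
    exact A.exec_nonneg _ _
  have hbdd : BddAbove E := ⟨t, fun s hs => hs.1.2.le⟩
  refine le_of_forall_pos_le_add fun ε hε => ?_
  -- A job running at `s` is still unfinished at `s`; choosing `s` within `ε` of the last time it
  -- runs leaves at most `ε` of service uncounted.
  obtain ⟨s, hs, hlt⟩ := exists_lt_of_lt_csSup hne (sub_lt_self (sSup E) hε)
  have hsub : E ⊆ {u : ℝ | u ∈ Set.Ico 0 s ∧ σ u = some J} ∪ Set.Icc s (sSup E) := by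
    intro u hu
    rcases lt_or_ge u s with h | h
    · exact Or.inl ⟨⟨hu.1.1, h⟩, hu.2⟩
    · exact Or.inr ⟨h, le_csSup hbdd hu⟩
  have hs_le : s ≤ sSup E := le_csSup hbdd hs
  have hfin : MeasureTheory.volume
      ({u : ℝ | u ∈ Set.Ico 0 s ∧ σ u = some J} ∪ Set.Icc s (sSup E)) ≠ ⊤ :=
    (MeasureTheory.measure_union_lt_top (service_set_ne_top σ J s).lt_top measure_Icc_lt_top).ne
  calc service σ J t ≤ service σ J s + MeasureTheory.volume.real (Set.Icc s (sSup E)) :=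
        (MeasureTheory.measureReal_mono hsub hfin).trans
          (MeasureTheory.measureReal_union_le _ _)
    _ ≤ A.exec J.1 J.2 + ε := by
        rw [Real.volume_real_Icc_of_le hs_le]
        have := (hσ.ready s J hs.2).2
        linarith

theorem Arrivals.release_add_le (A : S.Arrivals) (i : ι) (j m : ℕ) :
    A.release i j + m * S.T i ≤ A.release i (j + m) := by
  induction m with
  | zero => simp
  | succ m ih =>
    have := A.release_sep i (j + m)
    rw [← add_assoc]
    push_cast
    linarith

/-- The jobs of a task that are released in a half-open window of length `t` are among
`⌈t / T i⌉` consecutive ones. -/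
theorem Arrivals.exists_release_window (A : S.Arrivals) (i : ι) (t₀ t : ℝ) :
    ∃ a : ℕ, ∀ j, t₀ ≤ A.release i j → A.release i j < t₀ + t →
      j ∈ Finset.Ico a (a + ⌈t / S.T i⌉₊) := by
  classical
  by_cases h : ∃ j, t₀ ≤ A.release i j
  · refine ⟨Nat.find h, fun j hj hjt => ?_⟩
    have hle : Nat.find h ≤ j := Nat.find_min' h hj
    obtain ⟨m, rfl⟩ := Nat.exists_eq_add_of_le hle
    have h1 := A.release_add_le i (Nat.find h) m
    have h2 := Nat.find_spec h
    have h3 : (m : ℝ) < t / S.T i := by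
      rw [lt_div_iff₀ (S.T_pos i)]
      linarith
    have h4 := Nat.lt_ceil.mpr h3
    simp only [Finset.mem_Ico]
    omega
  · exact ⟨0, fun j hj _ => absurd ⟨j, hj⟩ h⟩

/-- At time `t`, all jobs of priority at least that of `k` that were released earlier are finished. -/
def Arrivals.Quiet (A : S.Arrivals) (σ : ℝ → Option (ι × ℕ)) (k : ι) (t : ℝ) : Prop :=
  ∀ J : ι × ℕ, S.prio J.1 ≤ S.prio k → A.release J.1 J.2 < t →
    A.exec J.1 J.2 ≤ service σ J t

theorem Arrivals.quiet_zero (A : S.Arrivals) (σ : ℝ → Option (ι × ℕ)) (k : ι) :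
    A.Quiet σ k 0 :=
  fun J _ h => absurd (A.release_nonneg J.1 J.2) h.not_ge

/-- Quiet times are closed under suprema: only releases strictly before the supremum matter, and
each of these precedes some quiet time. -/
theorem Arrivals.exists_last_quiet (A : S.Arrivals) (σ : ℝ → Option (ι × ℕ)) (k : ι) {r : ℝ}
    (hr : 0 ≤ r) :
    ∃ t₀, 0 ≤ t₀ ∧ t₀ ≤ r ∧ A.Quiet σ k t₀ ∧ ∀ t, A.Quiet σ k t → t ≤ r → t ≤ t₀ := by
  set Q : Set ℝ := {t | A.Quiet σ k t ∧ t ≤ r}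
  have h0 : (0 : ℝ) ∈ Q := ⟨A.quiet_zero σ k, hr⟩
  have hbdd : BddAbove Q := ⟨r, fun t ht => ht.2⟩
  refine ⟨sSup Q, le_csSup hbdd h0, csSup_le ⟨0, h0⟩ fun t ht => ht.2, ?_,
    fun t ht htr => le_csSup hbdd ⟨ht, htr⟩⟩
  intro J hJ hlt
  obtain ⟨t, ht, hJt⟩ := exists_lt_of_lt_csSup ⟨0, h0⟩ hlt
  exact (ht.1 J hJ hJt).trans (service_mono σ J (le_csSup hbdd ht))

variable [Fintype ι]

/-- If the workload that can be released in a window of length `t` is at most `t`, then a quiet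
time is followed by another one within distance `t`. -/
theorem Arrivals.Quiet.exists_next (hσ : IsFixedPrioritySchedule A σ) {k : ι} {t₀ t : ℝ}
    (h₀ : 0 ≤ t₀) (hq : A.Quiet σ k t₀) (ht : 0 < t)
    (hW : ∑ i with S.prio i ≤ S.prio k, (⌈t / S.T i⌉₊ : ℝ) * S.C i ≤ t) :
    ∃ t₁, t₀ < t₁ ∧ t₁ ≤ t₀ + t ∧ A.Quiet σ k t₁ := by
  by_contra! hcon
  choose a ha using fun i => A.exists_release_window i t₀ t
  let F : Finset (Σ _ : ι, ℕ) :=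
    ({i | S.prio i ≤ S.prio k} : Finset ι).sigma fun i => Finset.Ico (a i) (a i + ⌈t / S.T i⌉₊)
  have hF : ∀ J : ι × ℕ, S.prio J.1 ≤ S.prio k → t₀ ≤ A.release J.1 J.2 →
      A.release J.1 J.2 < t₀ + t → (⟨J.1, J.2⟩ : Σ _ : ι, ℕ) ∈ F := by
    intro J h1 h2 h3
    exact Finset.mem_sigma.mpr ⟨by simpa using h1, ha _ _ h2 h3⟩
  have hrel : ∀ J : ι × ℕ, S.prio J.1 ≤ S.prio k → ∀ u, t₀ ≤ u →
      service σ J u < A.exec J.1 J.2 → t₀ ≤ A.release J.1 J.2 := by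
    intro J hJ u hu hs
    by_contra! h
    exact absurd ((hq J hJ h).trans (service_mono σ J hu)) hs.not_ge
  -- Without a quiet time in the window, some job of priority at least that of `k` is always
  -- pending, so the processor never idles or runs lower-priority work. The running job was released
  -- inside the window, hence lies in `F`.
  have hsub : Set.Ioo t₀ (t₀ + t) ⊆
      ⋃ x ∈ F, {s : ℝ | s ∈ Set.Ico 0 (t₀ + t) ∧ σ s = some (x.1, x.2)} := by
    intro u hu
    obtain ⟨J', hJ', hJ'u, hJ's⟩ : ∃ J : ι × ℕ, S.prio J.1 ≤ S.prio k ∧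
        A.release J.1 J.2 < u ∧ service σ J u < A.exec J.1 J.2 := by
      simpa [Arrivals.Quiet] using hcon u hu.1 hu.2.le
    have hready : A.Ready σ J' u := ⟨hJ'u.le, hJ's⟩
    cases hJ : σ u with
    | none => exact absurd hready (hσ.idle u hJ J')
    | some J =>
      have hprec := hσ.highest u J hJ J' hready
      have hprio : S.prio J.1 ≤ S.prio k :=
        (not_lt.mp fun h => hprec (Or.inl h)).trans hJ'
      have hJr := hσ.ready u J hJ
      have hmem := hF J hprio (hrel J hprio u hu.1.le hJr.2) (hJr.1.trans_lt hu.2)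
      exact Set.mem_biUnion hmem ⟨⟨h₀.trans hu.1.le, hu.2⟩, hJ⟩
  have hfin : MeasureTheory.volume
      (⋃ x ∈ F, {s : ℝ | s ∈ Set.Ico 0 (t₀ + t) ∧ σ s = some (x.1, x.2)}) ≠ ⊤ :=
    ne_top_of_le_ne_top (measure_Ico_lt_top (a := (0 : ℝ)) (b := t₀ + t)).ne
      (MeasureTheory.measure_mono (Set.iUnion₂_subset fun _ _ _ hs => hs.1))
  have hlow : t ≤ ∑ x ∈ F, service σ (x.1, x.2) (t₀ + t) := by
    have h1 := (MeasureTheory.measureReal_mono hsub hfin).trans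
      (MeasureTheory.measureReal_biUnion_finset_le F _)
    rw [Real.volume_real_Ioo_of_le (by linarith)] at h1
    simpa [service] using h1
  have hup : ∑ x ∈ F, A.exec x.1 x.2 ≤ t := by
    refine le_trans ?_ hW
    rw [Finset.sum_sigma]
    refine Finset.sum_le_sum fun i _ => ?_
    calc ∑ j ∈ Finset.Ico (a i) (a i + ⌈t / S.T i⌉₊), A.exec i j
        ≤ ∑ _j ∈ Finset.Ico (a i) (a i + ⌈t / S.T i⌉₊), S.C i :=
          Finset.sum_le_sum fun j _ => A.exec_le i j
      _ = (⌈t / S.T i⌉₊ : ℝ) * S.C i := by simp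
  obtain ⟨J, hJ, hJr, hJs⟩ : ∃ J : ι × ℕ, S.prio J.1 ≤ S.prio k ∧
      A.release J.1 J.2 < t₀ + t ∧ service σ J (t₀ + t) < A.exec J.1 J.2 := by
    simpa [Arrivals.Quiet] using hcon (t₀ + t) (by linarith) le_rfl
  have hmem := hF J hJ (hrel J hJ _ (by linarith) hJs) hJr
  -- The window's end is not quiet either, so a job of `F` is unfinished there. The total service is
  -- then strictly below the total demand, which is at most `t`, contradicting `hlow`.
  have := Finset.sum_lt_sum (fun x (_ : x ∈ F) => service_le_exec hσ (x.1, x.2) (t₀ + t))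
    ⟨_, hmem, hJs⟩
  linarith

/-- Time-demand test: if the workload that can be released in some window of length `t ≤ D k` is
at most `t`, then task `k` is schedulable. -/
theorem schedulable_of_workload_le {k : ι} {t : ℝ} (ht : 0 < t) (htD : t ≤ S.D k)
    (hW : ∑ i with S.prio i ≤ S.prio k, (⌈t / S.T i⌉₊ : ℝ) * S.C i ≤ t) :
    S.Schedulable k := by
  intro A σ hσ j
  obtain ⟨t₀, h₀, h₀r, hq, hmax⟩ := A.exists_last_quiet σ k (A.release_nonneg k j)
  obtain ⟨t₁, h01, h1t, hq₁⟩ := hq.exists_next hσ h₀ ht hW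
  have hr : A.release k j < t₁ := by
    by_contra! h
    exact absurd (hmax t₁ hq₁ h) h01.not_ge
  exact (hq₁ (k, j) le_rfl hr).trans (service_mono σ _ (by linarith))

end Service

/-! ### Hyperbolic and utilization bounds -/

section Bounds

variable {ι : Type*}

/-- Add the indices in increasing order of `t`: each new `t a` is at most the sum built so far, so
adding `t a * u a` multiplies that sum by at most `u a + 1`. -/
theorem add_sum_mul_le_mul_prod_one_add (s : Finset ι) (t u : ι → ℝ) (c : ℝ)
    (hu : ∀ i ∈ s, 0 ≤ u i) (h : ∀ j ∈ s, t j ≤ c + ∑ i ∈ s with t i < t j, t i * u i)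
    (ht : ∀ i ∈ s, 0 ≤ t i) :
    c + ∑ i ∈ s, t i * u i ≤ c * ∏ i ∈ s, (u i + 1) := by
  classical
  induction s using Finset.induction_on_max_value t with
  | empty => simp
  | insert a s has hmax ih =>
    have hs := ih (fun i hi => hu i (Finset.mem_insert_of_mem hi))
      (fun j hj => by
        have := h j (Finset.mem_insert_of_mem hj)
        rwa [Finset.filter_insert, if_neg (hmax j hj).not_gt] at this)
      (fun i hi => ht i (Finset.mem_insert_of_mem hi))
    have hua := hu a (Finset.mem_insert_self a s)
    have hta : t a ≤ c + ∑ i ∈ s, t i * u i := by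
      refine (h a (Finset.mem_insert_self a s)).trans ?_
      rw [Finset.filter_insert, if_neg (lt_irrefl _)]
      rw [add_le_add_iff_left]
      refine Finset.sum_le_sum_of_subset_of_nonneg (Finset.filter_subset _ s) fun i hi _ => ?_
      exact mul_nonneg (ht i (Finset.mem_insert_of_mem hi)) (hu i (Finset.mem_insert_of_mem hi))
    rw [Finset.sum_insert has, Finset.prod_insert has]
    calc c + (t a * u a + ∑ i ∈ s, t i * u i)
        ≤ (c + ∑ i ∈ s, t i * u i) * (u a + 1) := by
          nlinarith [mul_le_mul_of_nonneg_right hta hua]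
      _ ≤ (c * ∏ i ∈ s, (u i + 1)) * (u a + 1) := by gcongr
      _ = c * ((u a + 1) * ∏ i ∈ s, (u i + 1)) := by ring

/-- The hyperbolic bound provides a point at which the workload of the tasks in `s` together with
an additional demand `c` is met. -/
theorem exists_workload_le_of_hyperbolic (s : Finset ι) (C T : ι → ℝ) {c D : ℝ}
    (hC : ∀ i ∈ s, 0 ≤ C i) (hT : ∀ i ∈ s, 0 < T i) (hTD : ∀ i ∈ s, T i < D)
    (hc : 0 < c) (hD : 0 < D) (h : (c / D + 1) * ∏ i ∈ s, (C i / T i + 1) ≤ 2) :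
    ∃ t, 0 < t ∧ t ≤ D ∧ c + ∑ i ∈ s, (⌈t / T i⌉₊ : ℝ) * C i ≤ t := by
  by_contra! hcon
  set n : ι → ℕ := fun i => ⌊D / T i⌋₊ with hn
  -- The last multiple of the period `T i` that does not exceed `D`.
  set t : ι → ℝ := fun i => n i * T i with htdef
  have hn1 : ∀ i ∈ s, (1 : ℝ) ≤ n i := by
    intro i hi
    have : 1 ≤ n i := Nat.le_floor (by
      rw [Nat.cast_one, one_le_div (hT i hi)]; exact (hTD i hi).le)
    exact_mod_cast this
  have htpos : ∀ i ∈ s, 0 < t i := fun i hi =>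
    mul_pos (zero_lt_one.trans_le (hn1 i hi)) (hT i hi)
  have htD : ∀ i ∈ s, t i ≤ D := by
    intro i hi
    have := Nat.floor_le (div_nonneg hD.le (hT i hi).le)
    exact (le_div_iff₀ (hT i hi)).mp this
  have htu : ∀ i ∈ s, t i * (C i / T i) = n i * C i := by
    intro i hi
    have := (hT i hi).ne'
    simp only [htdef]
    field_simp
  -- At most `n i + 1` jobs are released, and `n i + 1 ≤ 2 * n i` because `T i < D` forces `n i ≥
  -- 1`.
  have hceil : ∀ i ∈ s, ∀ x ≤ D, (⌈x / T i⌉₊ : ℝ) * C i ≤ n i * C i + n i * C i := by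
    intro i hi x hx
    have h1 : ⌈x / T i⌉₊ ≤ n i + 1 :=
      (Nat.ceil_mono (div_le_div_of_nonneg_right hx (hT i hi).le)).trans (Nat.ceil_le_floor_add_one _)
    have h2 : (⌈x / T i⌉₊ : ℝ) ≤ n i + 1 := by exact_mod_cast h1
    rw [← add_mul]
    exact mul_le_mul_of_nonneg_right (by linarith [hn1 i hi]) (hC i hi)
  have hceil' : ∀ i ∈ s, ∀ x ≤ t i, (⌈x / T i⌉₊ : ℝ) * C i ≤ n i * C i := by
    intro i hi x hx
    have h1 : ⌈x / T i⌉₊ ≤ n i := Nat.ceil_le.mpr ((div_le_iff₀ (hT i hi)).mpr hx)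
    exact mul_le_mul_of_nonneg_right (by exact_mod_cast h1) (hC i hi)
  -- `R` counts `n i` jobs of every task. At the candidate `t j`, only tasks with `t i < t j` can
  -- demand more, and by `hceil` at most the same amount again.
  set R : ℝ := c + ∑ i ∈ s, t i * (C i / T i) with hR
  have hstep : ∀ j ∈ s, t j ≤ R + ∑ i ∈ s with t i < t j, t i * (C i / T i) := by
    intro j hj
    refine (hcon (t j) (htpos j hj) (htD j hj)).le.trans ?_
    rw [hR, add_assoc, Finset.sum_filter, ← Finset.sum_add_distrib]
    gcongr with i hi
    rw [htu i hi]
    split_ifs with hlt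
    · exact hceil i hi _ (htD j hj)
    · rw [add_zero]
      exact hceil' i hi _ (not_lt.mp hlt)
  have hprod := add_sum_mul_le_mul_prod_one_add s t (fun i => C i / T i) R
    (fun i hi => div_nonneg (hC i hi) (hT i hi).le) hstep (fun i hi => (htpos i hi).le)
  have hlast : D < R + ∑ i ∈ s, t i * (C i / T i) := by
    refine (hcon D hD le_rfl).trans_le ?_
    rw [hR, add_assoc, ← Finset.sum_add_distrib]
    gcongr with i hi
    rw [htu i hi]
    exact hceil i hi _ le_rfl
  set P : ℝ := ∏ i ∈ s, (C i / T i + 1)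
  have h2 : (c + D) * P ≤ 2 * D := by
    have : (c / D + 1) * P * D = (c + D) * P := by field_simp
    rw [← this]
    exact mul_le_mul_of_nonneg_right h hD.le
  have hsum : ∑ i ∈ s, t i * (C i / T i) = R - c := by rw [hR]; ring
  rw [hsum] at hprod hlast
  have hRpos : 0 < R := by linarith
  -- Now `hprod` reads `2R - c ≤ RP` and `hlast` reads `D < 2R - c`. Multiplying `h2` by `R` and
  -- `hprod` by `D` gives `cRP ≤ cD`; cancelling `c > 0` yields `2R - c ≤ RP ≤ D`, a contradiction.
  have h3 : c * (R * P) ≤ c * D := by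
    have h4 := mul_le_mul_of_nonneg_left h2 hRpos.le
    have h5 := mul_le_mul_of_nonneg_left hprod hD.le
    nlinarith
  have h6 := le_of_mul_le_mul_left h3 hc
  linarith

/-- AM-GM via the tangent line of `exp`: with `a = 2 ^ (1 / N)`, each factor satisfies `y + 1 ≤ a *
exp ((y + 1) / a - 1)`. In the product the exponents add up to at most `0`, leaving `a ^ N = 2`. No
sign condition on `x` is needed. -/
theorem prod_add_one_le_of_sum_le (s : Finset ι) (u : ι → ℝ) (x : ℝ)
    (hu : ∀ i ∈ s, 0 ≤ u i)
    (h : x + ∑ i ∈ s, u i ≤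
      ((s.card + 1 : ℕ) : ℝ) * ((2 : ℝ) ^ (1 / ((s.card + 1 : ℕ) : ℝ)) - 1)) :
    (x + 1) * ∏ i ∈ s, (u i + 1) ≤ 2 := by
  set N : ℕ := s.card + 1 with hN
  have hN0 : (N : ℝ) ≠ 0 := by positivity
  set a : ℝ := (2 : ℝ) ^ (1 / (N : ℝ))
  have ha : 0 < a := by positivity
  have haN : a ^ N = 2 := by
    rw [← Real.rpow_natCast, ← Real.rpow_mul (by norm_num), one_div_mul_cancel hN0, Real.rpow_one]
  have hbound : ∀ y : ℝ, y + 1 ≤ a * Real.exp ((y + 1) / a - 1) := by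
    intro y
    have h1 := Real.add_one_le_exp ((y + 1) / a - 1)
    calc y + 1 = a * ((y + 1) / a - 1 + 1) := by field_simp; ring
      _ ≤ _ := mul_le_mul_of_nonneg_left h1 ha.le
  calc (x + 1) * ∏ i ∈ s, (u i + 1)
      ≤ (a * Real.exp ((x + 1) / a - 1)) * ∏ i ∈ s, (a * Real.exp ((u i + 1) / a - 1)) := by
        refine mul_le_mul (hbound x) (Finset.prod_le_prod (fun i hi => ?_) fun i _ => hbound _)
          (Finset.prod_nonneg fun i hi => ?_) (by positivity)
        · linarith [hu i hi]
        · linarith [hu i hi]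
    _ = a ^ N * Real.exp ((x + ∑ i ∈ s, u i + N) / a - N) := by
        rw [Finset.prod_mul_distrib, Finset.prod_const, ← Real.exp_sum, Finset.sum_sub_distrib,
          ← Finset.sum_div, Finset.sum_add_distrib, Finset.sum_const, hN,
          pow_succ, mul_mul_mul_comm, ← Real.exp_add, mul_comm a]
        congr 2
        simp only [nsmul_eq_mul, mul_one]
        push_cast
        ring
    _ ≤ 2 * 1 := by
        rw [haN]
        gcongr
        rw [Real.exp_le_one_iff, sub_nonpos, div_le_iff₀ ha]
        linarith
    _ = 2 := mul_one 2

end Bounds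

/-! ### Demand of the task system and conclusion -/

section Workload

variable {ι : Type*} [Fintype ι]

theorem workload_le (S : SporadicSystem ι) (k : ι) {t : ℝ} (ht : t ≤ S.D k) :
    ∑ i with S.prio i ≤ S.prio k, (⌈t / S.T i⌉₊ : ℝ) * S.C i ≤
      S.C' k + ∑ i ∈ S.hp₁ k, (⌈t / S.T i⌉₊ : ℝ) * S.C i := by
  classical
  have hset : ({i | S.prio i ≤ S.prio k} : Finset ι) = insert k (S.hp k) := by
    ext i
    simp [hp, le_iff_lt_or_eq, S.prio_injective.eq_iff, or_comm]
  have hk : k ∉ S.hp k := by simp [hp]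
  have hsplit := Finset.sum_filter_add_sum_filter_not (S.hp k) (fun i => S.T i < S.D k)
    (fun i => (⌈t / S.T i⌉₊ : ℝ) * S.C i)
  simp only [not_lt] at hsplit
  have h1 : (⌈t / S.T k⌉₊ : ℝ) * S.C k ≤ (⌈S.D k / S.T k⌉ : ℝ) * S.C k := by
    refine mul_le_mul_of_nonneg_right ?_ (S.C_nonneg k)
    rw [← natCast_ceil_eq_intCast_ceil (div_nonneg (S.D_pos k).le (S.T_pos k).le)]
    exact_mod_cast Nat.ceil_mono (div_le_div_of_nonneg_right ht (S.T_pos k).le)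
  have h2 : ∑ i ∈ S.hp₂ k, (⌈t / S.T i⌉₊ : ℝ) * S.C i ≤ ∑ i ∈ S.hp₂ k, S.C i := by
    refine Finset.sum_le_sum fun i hi => ?_
    have hle : S.D k ≤ S.T i := (Finset.mem_filter.mp hi).2
    have hc : ⌈t / S.T i⌉₊ ≤ 1 := by
      rw [Nat.ceil_le, Nat.cast_one, div_le_one (S.T_pos i)]
      exact ht.trans hle
    exact mul_le_of_le_one_left (S.C_nonneg i) (by exact_mod_cast hc)
  rw [hset, Finset.sum_insert hk, ← hsplit]
  unfold C'
  unfold hp₁ hp₂ at *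
  linarith

theorem le_C' (S : SporadicSystem ι) (k : ι) : S.C k ≤ S.C' k := by
  have h1 : (1 : ℝ) ≤ (⌈S.D k / S.T k⌉ : ℝ) := by
    exact_mod_cast Int.ceil_pos.mpr (div_pos (S.D_pos k) (S.T_pos k))
  have h2 : 0 ≤ ∑ i ∈ S.hp₂ k, S.C i := Finset.sum_nonneg fun i _ => S.C_nonneg i
  have h3 := mul_le_mul_of_nonneg_right h1 (S.C_nonneg k)
  unfold C'
  linarith

theorem schedulable_of_hyperbolic (S : SporadicSystem ι) (k : ι)
    (h : (S.C' k / S.D k + 1) * ∏ j ∈ S.hp₁ k, (S.U j + 1) ≤ 2) : S.Schedulable k := by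
  -- The hyperbolic argument divides by `C' k`, so `C k = 0` is treated apart: such jobs need no
  -- service.
  rcases (S.C_nonneg k).eq_or_lt with h0 | hpos
  · intro A σ _ j
    exact ((A.exec_le k j).trans h0.ge).trans (service_nonneg _ _ _)
  obtain ⟨t, ht, htD, hW⟩ := exists_workload_le_of_hyperbolic (S.hp₁ k) S.C S.T
    (fun i _ => S.C_nonneg i) (fun i _ => S.T_pos i) (fun i hi => (Finset.mem_filter.mp hi).2)
    (hpos.trans_le (S.le_C' k)) (S.D_pos k) h
  exact schedulable_of_workload_le ht htD ((S.workload_le k htD).trans hW)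

end Workload

end SporadicSystem

theorem mainTheorem7 {ι : Type*} [Fintype ι] (S : SporadicSystem ι) (k : ι)
    (h : (S.C' k / S.D k + 1) * ∏ j ∈ S.hp₁ k, (S.U j + 1) ≤ 2 ∨
      S.C' k / S.D k + ∑ j ∈ S.hp₁ k, S.U j ≤
        (S.kStar k : ℝ) * ((2 : ℝ) ^ (1 / (S.kStar k : ℝ)) - 1)) :
    S.Schedulable k := by
  refine S.schedulable_of_hyperbolic k (h.elim id fun h => ?_)
  exact SporadicSystem.prod_add_one_le_of_sum_le _ _ _
    (fun i _ => div_nonneg (S.C_nonneg i) (S.T_pos i).le) h
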